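/- Let $d\ge 3$ be an integer and $a_c=\frac{d-2}{2}$. Let $(a,b)\in\Theta=\{(a,b)\in\mathbf R^2:\ a\le b\le a+1,\ a<a_c\}$ and put $$p=\frac{2d}{d-2+2(b-a)},\qquad n=\frac{d}{1+a-b},\qquad \alpha=1+a-\frac{pb}{2}.$$ Assume $\alpha>0$ (equivalently $b<a+1$, that is, $n<\infty$), and let $\rho=\alpha^2(n-1)$. The spherical CKN space is the weighted Riemannian manifold $(M,\bar{\mathfrak g},\bar\mu)$ with $M=\mathbf R^d\setminus\{0\}$, inverse metric and measure $$\bar{\mathfrak g}^{ij}=|x|^{2(1-\alpha)}\frac{(1+|x|^{2\alpha})^2}{4}\,\delta^{ij},\qquad d\bar\mu=2^n\frac{|x|^{-bp}}{(1+|x|^{2\alpha})^n}\,dx .$$ A weighted Riemannian manifold $(M,\mathfrak g,\mu)$ with $d\mu=e^{-W}dV_{\mathfrak g}$, $W\in C^\infty(M)$, satisfies $CD(\rho,n)$ if for every $f\in C^\infty(M)$, at every point of $M$, $$\Gamma_2(f)\ \ge\ \rho\,\Gamma(f)+\frac1n (Lf)^2,$$ where $\Gamma(f,h)=\mathfrak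 g^{ij}\partial_i f\,\partial_j h$, $\Gamma(f)=\Gamma(f,f)$, $Lf=\Delta_{\mathfrak g}f-\Gamma(W,f)$ and $\Gamma_2(f)=\frac12L(\Gamma(f))-\Gamma(f,Lf)$. Then the spherical CKN space satisfies $CD(\rho,n)$ if and only if $$\alpha^2\le\frac{d-2}{n-2},$$ and this inequality is equivalent to $\mathfrak B_{DGZ}:=(d-2)-(n-2)\alpha^2\ge 0$. -/

import Mathlib

open scoped ContDiff

noncomputable section

/-- A weighted Riemannian manifold `(M, 𝔤, μ)` of dimension `d` that is covered by one chart: `M` is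
an open subset of `ℝ^d`, the metric is given through the matrix `𝔤^{ij}` of the bilinear form
on the cotangent space (the inverse of the matrix `g_{ij}`), and `dμ = density(x) dx`. -/
structure WeightedManifold (d : ℕ) where
  carrier : Set (EuclideanSpace ℝ (Fin d))
  isOpen_carrier : IsOpen carrier
  cometric : EuclideanSpace ℝ (Fin d) → Matrix (Fin d) (Fin d) ℝ
  contDiffOn_cometric : ∀ i j, ContDiffOn ℝ ∞ (fun x => cometric x i j) carrier
  posDef_cometric : ∀ x ∈ carrier, (cometric x).PosDef
  density : EuclideanSpace ℝ (Fin d) → ℝ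
  contDiffOn_density : ContDiffOn ℝ ∞ density carrier
  density_pos : ∀ x ∈ carrier, 0 < density x

namespace WeightedManifold

variable {d : ℕ} (M : WeightedManifold d)

/-- The partial derivative `∂_i f (x)`. -/
def partialDeriv (i : Fin d) (f : EuclideanSpace ℝ (Fin d) → ℝ) (x : EuclideanSpace ℝ (Fin d)) : ℝ :=
  fderiv ℝ f x (EuclideanSpace.single i 1)

/-- The density `√(det g_{ij}) = 1 / √(det 𝔤^{ij})` of the Riemannian volume `dV` with respect to
Lebesgue measure. -/
def volDensity (x : EuclideanSpace ℝ (Fin d)) : ℝ :=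
  (Real.sqrt (M.cometric x).det)⁻¹

/-- The weight `W`, characterized by `dμ = e^{-W} dV`. -/
def weight (x : EuclideanSpace ℝ (Fin d)) : ℝ :=
  -Real.log (M.density x / M.volDensity x)

/-- The bilinear carré du champ `Γ(f, h) = ∑_{i,j} 𝔤^{ij} ∂_i f ∂_j h`; in particular
`Γ(f, f) = |∇f|²` is the squared Riemannian length of the gradient. -/
def carreDuChamp (f h : EuclideanSpace ℝ (Fin d) → ℝ) (x : EuclideanSpace ℝ (Fin d)) : ℝ :=
  ∑ i, ∑ j, M.cometric x i j * partialDeriv i f x * partialDeriv j h x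

/-- The Laplace-Beltrami operator `Δf = (det g)^{-1/2} ∑_{i,j} ∂_i ((det g)^{1/2} 𝔤^{ij} ∂_j f)`. -/
def laplaceBeltrami (f : EuclideanSpace ℝ (Fin d) → ℝ) (x : EuclideanSpace ℝ (Fin d)) : ℝ :=
  (M.volDensity x)⁻¹ *
    ∑ i, partialDeriv i (fun y => M.volDensity y * ∑ j, M.cometric y i j * partialDeriv j f y) x

/-- The generator `Lf = Δf - Γ(W, f)`. -/
def generator (f : EuclideanSpace ℝ (Fin d) → ℝ) (x : EuclideanSpace ℝ (Fin d)) : ℝ :=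
  M.laplaceBeltrami f x - M.carreDuChamp M.weight f x

/-- The iterated carré du champ `Γ₂(f) = ½ L(Γ(f)) - Γ(f, Lf)`. -/
def gammaTwo (f : EuclideanSpace ℝ (Fin d) → ℝ) (x : EuclideanSpace ℝ (Fin d)) : ℝ :=
  1 / 2 * M.generator (M.carreDuChamp f f) x - M.carreDuChamp f (M.generator f) x

/-- The curvature-dimension condition `CD(ρ, n)`: for every `f ∈ C^∞(M)`, everywhere on `M`,
`Γ₂(f) ≥ ρ Γ(f) + (Lf)² / n`. -/
def CurvatureDimension (ρ n : ℝ) : Prop :=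
  ∀ f : EuclideanSpace ℝ (Fin d) → ℝ, ContDiffOn ℝ ∞ f M.carrier → ∀ x ∈ M.carrier,
    ρ * M.carreDuChamp f f x + 1 / n * (M.generator f x) ^ 2 ≤ M.gammaTwo f x

end WeightedManifold

namespace CKN

/-- `a_c = (d - 2) / 2`. -/
def aCrit (d : ℕ) : ℝ := ((d : ℝ) - 2) / 2

/-- The parameter set `Θ = {(a, b) : a ≤ b ≤ a + 1, a < a_c}`. -/
def Theta (d : ℕ) : Set (ℝ × ℝ) :=
  {q | q.1 ≤ q.2 ∧ q.2 ≤ q.1 + 1 ∧ q.1 < aCrit d}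

/-- The critical exponent `p = 2d / (d - 2 + 2(b - a))`. -/
def pCrit (d : ℕ) (a b : ℝ) : ℝ := 2 * (d : ℝ) / ((d : ℝ) - 2 + 2 * (b - a))

/-- The intrinsic dimension `n = d / (1 + a - b)` (finite for `b < a + 1`). -/
def intrinsicDim (d : ℕ) (a b : ℝ) : ℝ := (d : ℝ) / (1 + a - b)

/-- `α = 1 + a - pb/2`. -/
def alpha (d : ℕ) (a b : ℝ) : ℝ := 1 + a - pCrit d a b * b / 2

/-- `𝔅 = (d - 2) - (n - 2) α²`. -/
def bDGZ (d : ℕ) (a b : ℝ) : ℝ :=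
  ((d : ℝ) - 2) - (intrinsicDim d a b - 2) * alpha d a b ^ 2

/-- The spherical CKN space: `M = ℝ^d ∖ {0}`,
`𝔤^{ij} = |x|^{2(1-α)} (1 + |x|^{2α})² / 4 δ^{ij}`, `dμ = 2^n |x|^{-bp} / (1 + |x|^{2α})^n dx`. -/
def sphericalSpace (d : ℕ) (a b : ℝ) : WeightedManifold d where
  carrier := {0}ᶜ
  isOpen_carrier := isOpen_compl_singleton
  cometric x :=
    (‖x‖ ^ (2 * (1 - alpha d a b)) * (1 + ‖x‖ ^ (2 * alpha d a b)) ^ 2 / 4) •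
      (1 : Matrix (Fin d) (Fin d) ℝ)
  contDiffOn_cometric i j := by
    intro x hx
    have hx : x ≠ 0 := hx
    have h1 : ∀ r : ℝ, ContDiffAt ℝ ∞ (fun y : EuclideanSpace ℝ (Fin d) => ‖y‖ ^ r) x := fun r =>
      (contDiffAt_norm ℝ hx).rpow_const_of_ne (norm_ne_zero_iff.mpr hx)
    simp only [Matrix.smul_apply, smul_eq_mul]
    exact ((((h1 _).mul ((contDiffAt_const.add (h1 _)).pow 2)).div_const 4).mul
      contDiffAt_const).contDiffWithinAt
  posDef_cometric x hx := by
    have hx : 0 < ‖x‖ := norm_pos_iff.mpr hx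
    exact Matrix.PosDef.one.smul (by positivity)
  density x :=
    (2 : ℝ) ^ intrinsicDim d a b * ‖x‖ ^ (-b * pCrit d a b) /
      (1 + ‖x‖ ^ (2 * alpha d a b)) ^ intrinsicDim d a b
  contDiffOn_density := by
    intro x hx
    have hx : x ≠ 0 := hx
    have h0 : 0 < ‖x‖ := norm_pos_iff.mpr hx
    have h1 : ∀ r : ℝ, ContDiffAt ℝ ∞ (fun y : EuclideanSpace ℝ (Fin d) => ‖y‖ ^ r) x := fun r =>
      (contDiffAt_norm ℝ hx).rpow_const_of_ne h0.ne'
    have h2 : (1 : ℝ) + ‖x‖ ^ (2 * alpha d a b) ≠ 0 := by positivity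
    refine ContDiffAt.contDiffWithinAt (ContDiffAt.div (contDiffAt_const.mul (h1 _))
      ((contDiffAt_const.add (h1 _)).rpow_const_of_ne h2) ?_)
    positivity
  density_pos x hx := by
    have hx : 0 < ‖x‖ := norm_pos_iff.mpr hx
    positivity

end CKN

end

/-! The space is conformally flat with radial data: `Γ(f) = c |∇f|²` and `Lf = c (Δf + s x·∇f)`. Put
`σ = scaledCos α r`, where `r = |x|`. Then `r c'/c = 2 - 2σ`, `r W' = -(n - d) σ`, `r σ' = -(α² -
σ²)`, and `c (α² - σ²) = α² r²`, so `Γ₂` can be computed explicitly in flat coordinates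
(`IsRadialConformal.gammaTwo_eq`).

Let `p = ∇f`, `P = x·p`, `μ = (1 - σ)/r²`, and let `H = D²f + μ (x ⊗ p + p ⊗ x) - μ P 1` be the
Riemannian Hessian. The key identity, `gammaTwo_sphericalSpace_sub`, says that `Γ₂(f) - ρ Γ(f) -
(Lf)²/n` equals `c² (|H|² - (tr H)²/d + (n - d)/(dn) (tr H - dσP/r²)²) + c² r⁻⁴ 𝔅 (r² |p|² - P²)`.

If `𝔅 ≥ 0`, every term is nonnegative: the first by `conformalHessian_trace_sq_le`, the second since
`n ≥ d`, the last by Cauchy-Schwarz. Conversely, a function with `H = 0` and nonzero tangential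
gradient at one point leaves only the `𝔅` term, so `CD(ρ, n)` forces `𝔅 ≥ 0`. -/

namespace WeightedManifold

/-! ### Calculus of partial derivatives on open sets -/

variable {d : ℕ} {U : Set (EuclideanSpace ℝ (Fin d))} {f g : EuclideanSpace ℝ (Fin d) → ℝ}
  {x : EuclideanSpace ℝ (Fin d)} {i : Fin d}

theorem partialDeriv_congr (hU : IsOpen U) (h : ∀ y ∈ U, f y = g y) (hx : x ∈ U) :
    partialDeriv i f x = partialDeriv i g x := by
  unfold partialDeriv
  rw [Filter.EventuallyEq.fderiv_eq]
  filter_upwards [hU.mem_nhds hx] with y hy using h y hy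

theorem partialDeriv_add (hf : DifferentiableAt ℝ f x) (hg : DifferentiableAt ℝ g x) :
    partialDeriv i (fun y => f y + g y) x = partialDeriv i f x + partialDeriv i g x := by
  simp [partialDeriv, fderiv_fun_add hf hg]

theorem partialDeriv_mul (hf : DifferentiableAt ℝ f x) (hg : DifferentiableAt ℝ g x) :
    partialDeriv i (fun y => f y * g y) x
      = partialDeriv i f x * g x + f x * partialDeriv i g x := by
  simp [partialDeriv, fderiv_fun_mul hf hg]
  ring

theorem partialDeriv_sum {ι : Type*} {s : Finset ι} {F : ι → EuclideanSpace ℝ (Fin d) → ℝ}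
    (hF : ∀ k ∈ s, DifferentiableAt ℝ (F k) x) :
    partialDeriv i (fun y => ∑ k ∈ s, F k y) x = ∑ k ∈ s, partialDeriv i (F k) x := by
  simp [partialDeriv, fderiv_fun_sum hF]

theorem differentiableAt_coord (j : Fin d) :
    DifferentiableAt ℝ (fun y : EuclideanSpace ℝ (Fin d) => y j) x := by
  fun_prop

theorem partialDeriv_coord (j : Fin d) :
    partialDeriv i (fun y : EuclideanSpace ℝ (Fin d) => y j) x = if i = j then 1 else 0 := by
  have h : HasFDerivAt (fun y : EuclideanSpace ℝ (Fin d) => y j)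
      (EuclideanSpace.proj j : EuclideanSpace ℝ (Fin d) →L[ℝ] ℝ) x :=
    (EuclideanSpace.proj j : EuclideanSpace ℝ (Fin d) →L[ℝ] ℝ).hasFDerivAt
  simp [partialDeriv, h.fderiv, eq_comm]

theorem differentiableAt_of_contDiffOn (hU : IsOpen U) (hf : ContDiffOn ℝ ∞ f U) (hx : x ∈ U) :
    DifferentiableAt ℝ f x :=
  (hf.contDiffAt (hU.mem_nhds hx)).differentiableAt (by simp)

theorem contDiffOn_partialDeriv (hU : IsOpen U) (hf : ContDiffOn ℝ ∞ f U) (i : Fin d) :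
    ContDiffOn ℝ ∞ (partialDeriv i f) U :=
  (hf.fderiv_of_isOpen hU (m := ∞) (by simp)).clm_apply contDiffOn_const

theorem partialDeriv_comm (hU : IsOpen U) (hf : ContDiffOn ℝ ∞ f U) (hx : x ∈ U) (i j : Fin d) :
    partialDeriv i (partialDeriv j f) x = partialDeriv j (partialDeriv i f) x := by
  have h1 : DifferentiableAt ℝ (fderiv ℝ f) x :=
    ((hf.fderiv_of_isOpen hU (m := ∞) (by simp)).contDiffAt (hU.mem_nhds hx)).differentiableAt
      (by simp)
  have h2 : ∀ i j : Fin d, partialDeriv i (partialDeriv j f) x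
      = fderiv ℝ (fderiv ℝ f) x (EuclideanSpace.single i 1) (EuclideanSpace.single j 1) := by
    intro i j
    have h := h1.hasFDerivAt.clm_apply (hasFDerivAt_const (EuclideanSpace.single j (1 : ℝ)) x)
    change fderiv ℝ (fun y => fderiv ℝ f y (EuclideanSpace.single j 1)) x _ = _
    rw [h.fderiv]
    simp
  rw [h2, h2]
  exact ((hf.contDiffAt (hU.mem_nhds hx)).isSymmSndFDerivAt
    (by simpa using ENat.LEInfty.out)).eq _ _

/-! ### Radial functions, and `Γ₂` for radial conformal data -/

/-- `F` has gradient `G(x) x` at every `x ≠ 0`. -/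
def HasRadialGradient (F G : EuclideanSpace ℝ (Fin d) → ℝ) : Prop :=
  ∀ x, x ≠ 0 → HasFDerivAt F (G x • innerSL ℝ x) x

theorem HasRadialGradient.differentiableAt (h : HasRadialGradient f g) (hx : x ≠ 0) :
    DifferentiableAt ℝ f x := (h x hx).differentiableAt

theorem HasRadialGradient.partialDeriv (h : HasRadialGradient f g) (hx : x ≠ 0) (i : Fin d) :
    partialDeriv i f x = g x * x i := by
  simp [WeightedManifold.partialDeriv, (h x hx).fderiv, EuclideanSpace.inner_single_right]

theorem hasRadialGradient_of_hasDerivAt {F G : ℝ → ℝ} (h : ∀ r, 0 < r → HasDerivAt F (r * G r) r) :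
    HasRadialGradient (fun x : EuclideanSpace ℝ (Fin d) => F ‖x‖) (fun x => G ‖x‖) := by
  intro x hx
  have hr : 0 < ‖x‖ := norm_pos_iff.mpr hx
  -- The gradient `x/|x|` of the norm, from that of `|x|²` through the square root.
  have h1 : HasFDerivAt (fun y : EuclideanSpace ℝ (Fin d) => ‖y‖) (‖x‖⁻¹ • innerSL ℝ x) x := by
    have h2 := (hasStrictFDerivAt_norm_sq x).hasFDerivAt.sqrt (by positivity)
    simp only [Real.sqrt_sq (norm_nonneg _)] at h2
    refine h2.congr_fderiv ?_
    ext y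
    simp
    field_simp
  refine ((h _ hr).comp_hasFDerivAt x h1).congr_fderiv ?_
  ext y
  simp
  field_simp

/-- The flat Laplacian `∑ ∂_i ∂_i f`. -/
noncomputable def flatLaplacian (f : EuclideanSpace ℝ (Fin d) → ℝ)
    (x : EuclideanSpace ℝ (Fin d)) : ℝ :=
  ∑ i, partialDeriv i (partialDeriv i f) x

/-- The Euler field `∑ x_i ∂_i f`. -/
noncomputable def eulerField (f : EuclideanSpace ℝ (Fin d) → ℝ)
    (x : EuclideanSpace ℝ (Fin d)) : ℝ :=
  ∑ i, x i * partialDeriv i f x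

/-- `M` is conformally flat on the punctured space, with radial conformal factor and drift:
`Γ(f,h) = c ∑ ∂_i f ∂_i h` and `L f = c (Δf + s x·∇f)`, with `∇c = c₁ x`, `∇c₁ = c₂ x`,
`∇s = s₁ x`. -/
structure IsRadialConformal (M : WeightedManifold d)
    (c c₁ c₂ s s₁ : EuclideanSpace ℝ (Fin d) → ℝ) : Prop where
  contDiffOn_factor : ContDiffOn ℝ ∞ c {0}ᶜ
  factor : HasRadialGradient c c₁
  factor_deriv : HasRadialGradient c₁ c₂
  drift : HasRadialGradient s s₁
  carreDuChamp_eq : ∀ f h x, M.carreDuChamp f h x = c x * ∑ i, partialDeriv i f x * partialDeriv i h x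
  generator_eq : ∀ f, ContDiffOn ℝ ∞ f {0}ᶜ → ∀ x, x ≠ 0 →
    M.generator f x = c x * (flatLaplacian f x + s x * eulerField f x)

/-- The third derivatives of `f` in `½ L(Γ(f))` and in `Γ(f, Lf)` cancel once mixed derivatives are
commuted. What remains is quadratic in the first and second derivatives. -/
theorem IsRadialConformal.gammaTwo_eq {M : WeightedManifold d}
    {c c₁ c₂ s s₁ : EuclideanSpace ℝ (Fin d) → ℝ} (hM : M.IsRadialConformal c c₁ c₂ s s₁)
    (hf : ContDiffOn ℝ ∞ f {0}ᶜ) (hx : x ≠ 0) :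
    M.gammaTwo f x =
      c x ^ 2 * ∑ i, ∑ j, partialDeriv i (partialDeriv j f) x ^ 2
      + 2 * c x * c₁ x *
        ∑ i, ∑ j, x i * (partialDeriv i (partialDeriv j f) x * partialDeriv j f x)
      + c x / 2 * (d * c₁ x + (c₂ x + s x * c₁ x) * ‖x‖ ^ 2) * ∑ i, partialDeriv i f x ^ 2
      - c x * c₁ x * eulerField f x * (flatLaplacian f x + s x * eulerField f x)
      - c x ^ 2 * (s₁ x * eulerField f x ^ 2 + s x * ∑ i, partialDeriv i f x ^ 2) := by
  have hU : IsOpen ({0}ᶜ : Set (EuclideanSpace ℝ (Fin d))) := isOpen_compl_singleton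
  have hp : ∀ i, ContDiffOn ℝ ∞ (partialDeriv i f) {0}ᶜ := contDiffOn_partialDeriv hU hf
  have hA : ∀ i j, ContDiffOn ℝ ∞ (partialDeriv i (partialDeriv j f)) {0}ᶜ :=
    fun i j => contDiffOn_partialDeriv hU (hp j) i
  have dp : ∀ i y, y ≠ 0 → DifferentiableAt ℝ (partialDeriv i f) y :=
    fun i y hy => differentiableAt_of_contDiffOn hU (hp i) hy
  have dA : ∀ i j y, y ≠ 0 → DifferentiableAt ℝ (partialDeriv i (partialDeriv j f)) y :=
    fun i j y hy => differentiableAt_of_contDiffOn hU (hA i j) hy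
  have dc : ∀ y, y ≠ 0 → DifferentiableAt ℝ c y := fun y hy => hM.factor.differentiableAt hy
  have dc₁ : ∀ y, y ≠ 0 → DifferentiableAt ℝ c₁ y :=
    fun y hy => hM.factor_deriv.differentiableAt hy
  have ds : ∀ y, y ≠ 0 → DifferentiableAt ℝ s y := fun y hy => hM.drift.differentiableAt hy
  have hG : M.carreDuChamp f f = fun y => c y * ∑ j, partialDeriv j f y * partialDeriv j f y :=
    funext fun y => hM.carreDuChamp_eq f f y
  have hGs : ContDiffOn ℝ ∞ (M.carreDuChamp f f) {0}ᶜ := by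
    rw [hG]
    exact hM.contDiffOn_factor.mul (ContDiffOn.sum fun j _ => (hp j).mul (hp j))
  have dN : ∀ y, y ≠ 0 →
      DifferentiableAt ℝ (fun y => ∑ j, partialDeriv j f y * partialDeriv j f y) y :=
    fun y hy => DifferentiableAt.fun_sum fun j _ => (dp j y hy).fun_mul (dp j y hy)
  have dNA : ∀ i y, y ≠ 0 → DifferentiableAt ℝ
      (fun y => ∑ j, partialDeriv i (partialDeriv j f) y * partialDeriv j f y) y :=
    fun i y hy => DifferentiableAt.fun_sum fun j _ => (dA i j y hy).fun_mul (dp j y hy)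
  have hN1 : ∀ i y, y ≠ 0 → partialDeriv i
      (fun y => ∑ j, partialDeriv j f y * partialDeriv j f y) y
      = 2 * ∑ j, partialDeriv i (partialDeriv j f) y * partialDeriv j f y := by
    intro i y hy
    rw [partialDeriv_sum fun j _ => (dp j y hy).fun_mul (dp j y hy), Finset.mul_sum]
    refine Finset.sum_congr rfl fun j _ => ?_
    rw [partialDeriv_mul (dp j y hy) (dp j y hy)]
    ring
  have hG1 : ∀ i y, y ≠ 0 → partialDeriv i (M.carreDuChamp f f) y
      = c₁ y * y i * (∑ j, partialDeriv j f y * partialDeriv j f y)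
        + c y * (2 * ∑ j, partialDeriv i (partialDeriv j f) y * partialDeriv j f y) := by
    intro i y hy
    rw [hG, partialDeriv_mul (dc y hy) (dN y hy), hM.factor.partialDeriv hy, hN1 i y hy]
  have hG2 : ∀ i, partialDeriv i (partialDeriv i (M.carreDuChamp f f)) x
      = (c₂ x * x i * x i + c₁ x) * (∑ j, partialDeriv j f x * partialDeriv j f x)
        + 4 * c₁ x * (x i * ∑ j, partialDeriv i (partialDeriv j f) x * partialDeriv j f x)
        + 2 * c x * (∑ j, partialDeriv i (partialDeriv j f) x ^ 2)
        + 2 * c x * (∑ j, partialDeriv j f x * partialDeriv j (partialDeriv i (partialDeriv i f)) x)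
        := by
    intro i
    rw [partialDeriv_congr hU (fun y hy => hG1 i y hy) hx,
      partialDeriv_add (((dc₁ x hx).fun_mul (differentiableAt_coord i)).fun_mul (dN x hx))
        ((dc x hx).fun_mul ((dNA i x hx).const_mul 2)),
      partialDeriv_mul ((dc₁ x hx).fun_mul (differentiableAt_coord i)) (dN x hx),
      partialDeriv_mul (dc₁ x hx) (differentiableAt_coord i),
      partialDeriv_mul (dc x hx) ((dNA i x hx).const_mul 2),
      partialDeriv_mul (differentiableAt_const _) (dNA i x hx),
      partialDeriv_sum fun j _ => (dA i j x hx).fun_mul (dp j x hx),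
      hN1 i x hx, hM.factor_deriv.partialDeriv hx, hM.factor.partialDeriv hx, partialDeriv_coord]
    -- The derivatives are reordered with `∂_j` outermost, the shape in which they occur in `Γ(f,
    -- Lf)`.
    have h3 : ∀ j, partialDeriv i (fun y => partialDeriv i (partialDeriv j f) y
        * partialDeriv j f y) x = partialDeriv i (partialDeriv j f) x ^ 2
          + partialDeriv j f x * partialDeriv j (partialDeriv i (partialDeriv i f)) x := by
      intro j
      rw [partialDeriv_mul (dA i j x hx) (dp j x hx),
        partialDeriv_congr hU (fun y hy => partialDeriv_comm hU hf hy i j) hx,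
        partialDeriv_comm hU (hp i) hx i j]
      ring
    have h4 : partialDeriv i (fun _ : EuclideanSpace ℝ (Fin d) => (2 : ℝ)) x = 0 := by
      simp [partialDeriv]
    simp only [h3, h4, Finset.sum_add_distrib, if_true]
    ring
  have dE : DifferentiableAt ℝ (eulerField f) x :=
    DifferentiableAt.fun_sum fun j _ => (differentiableAt_coord j).fun_mul (dp j x hx)
  have dL : DifferentiableAt ℝ (flatLaplacian f) x :=
    DifferentiableAt.fun_sum fun j _ => dA j j x hx
  have hL : ∀ i, partialDeriv i (M.generator f) x
      = c₁ x * x i * (flatLaplacian f x + s x * eulerField f x)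
        + c x * ((∑ j, partialDeriv i (partialDeriv j (partialDeriv j f)) x)
          + s₁ x * x i * eulerField f x
          + s x * (partialDeriv i f x + ∑ j, x j * partialDeriv i (partialDeriv j f) x)) := by
    intro i
    have hE1 : partialDeriv i (eulerField f) x
        = partialDeriv i f x + ∑ j, x j * partialDeriv i (partialDeriv j f) x := by
      unfold eulerField
      rw [partialDeriv_sum fun j _ => (differentiableAt_coord j).fun_mul (dp j x hx)]
      simp only [partialDeriv_mul (differentiableAt_coord _) (dp _ x hx), partialDeriv_coord,
        Finset.sum_add_distrib]
      simp
    have hL1 : partialDeriv i (flatLaplacian f) x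
        = ∑ j, partialDeriv i (partialDeriv j (partialDeriv j f)) x := by
      unfold flatLaplacian
      rw [partialDeriv_sum fun j _ => dA j j x hx]
    rw [partialDeriv_congr hU (fun y hy => hM.generator_eq f hf y hy) hx,
      partialDeriv_mul (dc x hx) (dL.fun_add ((ds x hx).fun_mul dE)),
      partialDeriv_add dL ((ds x hx).fun_mul dE), partialDeriv_mul (ds x hx) dE, hE1, hL1,
      hM.factor.partialDeriv hx, hM.drift.partialDeriv hx]
    ring
  have hR : ‖x‖ ^ 2 = ∑ i, x i * x i := by
    rw [EuclideanSpace.real_norm_sq_eq]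
    exact Finset.sum_congr rfl fun i _ => sq _
  have hsq : ∑ j, partialDeriv j f x ^ 2 = ∑ j, partialDeriv j f x * partialDeriv j f x :=
    Finset.sum_congr rfl fun i _ => sq _
  have hlap : flatLaplacian (M.carreDuChamp f f) x
      = (c₂ x * ‖x‖ ^ 2 + d * c₁ x) * (∑ j, partialDeriv j f x ^ 2)
        + 4 * c₁ x * (∑ i, ∑ j, x i * (partialDeriv i (partialDeriv j f) x * partialDeriv j f x))
        + 2 * c x * (∑ i, ∑ j, partialDeriv i (partialDeriv j f) x ^ 2)
        + 2 * c x * (∑ i, ∑ j,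
          partialDeriv j f x * partialDeriv j (partialDeriv i (partialDeriv i f)) x) := by
    unfold flatLaplacian
    simp only [hG2, Finset.sum_add_distrib, ← Finset.mul_sum, ← Finset.sum_mul, hR, hsq, mul_assoc]
    simp
  have heul : eulerField (M.carreDuChamp f f) x
      = c₁ x * ‖x‖ ^ 2 * (∑ j, partialDeriv j f x ^ 2)
        + 2 * c x *
          ∑ i, ∑ j, x i * (partialDeriv i (partialDeriv j f) x * partialDeriv j f x) := by
    unfold eulerField
    have e : ∀ i, x i * partialDeriv i (M.carreDuChamp f f) x
        = c₁ x * (∑ j, partialDeriv j f x * partialDeriv j f x) * (x i * x i)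
          + 2 * c x * ∑ j, x i * (partialDeriv i (partialDeriv j f) x * partialDeriv j f x) := by
      intro i
      rw [hG1 i x hx, ← Finset.mul_sum]
      ring
    rw [hR, hsq, Finset.sum_congr rfl fun i _ => e i, Finset.sum_add_distrib, ← Finset.mul_sum,
      ← Finset.mul_sum]
    ring
  have hcross : ∑ i, partialDeriv i f x * partialDeriv i (M.generator f) x
      = c₁ x * eulerField f x * (flatLaplacian f x + s x * eulerField f x)
        + c x * ((∑ i, ∑ j,
            partialDeriv j f x * partialDeriv j (partialDeriv i (partialDeriv i f)) x)
          + s₁ x * eulerField f x ^ 2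
          + s x * ((∑ j, partialDeriv j f x ^ 2) + ∑ i, ∑ j,
            x i * (partialDeriv i (partialDeriv j f) x * partialDeriv j f x))) := by
    have e1 : ∑ i, ∑ j, partialDeriv j f x * partialDeriv j (partialDeriv i (partialDeriv i f)) x
        = ∑ i, partialDeriv i f x * ∑ j, partialDeriv i (partialDeriv j (partialDeriv j f)) x := by
      rw [Finset.sum_comm]
      simp only [Finset.mul_sum]
    have e2 : ∑ i, ∑ j, x i * (partialDeriv i (partialDeriv j f) x * partialDeriv j f x)
        = ∑ i, partialDeriv i f x * ∑ j, x j * partialDeriv i (partialDeriv j f) x := by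
      rw [Finset.sum_comm]
      refine Finset.sum_congr rfl fun i _ => ?_
      rw [Finset.mul_sum]
      refine Finset.sum_congr rfl fun j _ => ?_
      rw [partialDeriv_comm hU hf hx i j]
      ring
    rw [e1, e2, hsq]
    have e3 : ∀ i, partialDeriv i f x * partialDeriv i (M.generator f) x
        = (c₁ x * (flatLaplacian f x + s x * eulerField f x) + c x * s₁ x * eulerField f x)
            * (x i * partialDeriv i f x)
          + c x * (partialDeriv i f x * ∑ j, partialDeriv i (partialDeriv j (partialDeriv j f)) x)
          + c x * s x * (partialDeriv i f x * partialDeriv i f x)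
          + c x * s x
            * (partialDeriv i f x * ∑ j, x j * partialDeriv i (partialDeriv j f) x) := by
      intro i
      rw [hL i]
      ring
    have e4 : eulerField f x = ∑ i, x i * partialDeriv i f x := rfl
    rw [Finset.sum_congr rfl fun i _ => e3 i]
    rw [Finset.sum_add_distrib, Finset.sum_add_distrib, Finset.sum_add_distrib, ← Finset.mul_sum,
      ← Finset.mul_sum, ← Finset.mul_sum, ← Finset.mul_sum, ← e4]
    ring
  rw [gammaTwo, hM.generator_eq _ hGs x hx, hM.carreDuChamp_eq f, hcross, hlap, heul]
  ring

end WeightedManifold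

/-! ### Radial profiles of the conformal factor, volume and weight -/

namespace CKN

/-- `α (1 - r^{2α}) / (1 + r^{2α})`: the cosine of the polar angle, times `α`. -/
noncomputable def scaledCos (α r : ℝ) : ℝ := α * (1 - r ^ (2 * α)) / (1 + r ^ (2 * α))

/-- The radial profile `r^{2(1-α)} (1 + r^{2α})² / 4` of the conformal factor. -/
noncomputable def conformalProfile (α r : ℝ) : ℝ :=
  r ^ (2 * (1 - α)) * (1 + r ^ (2 * α)) ^ 2 / 4

variable {α r : ℝ}

theorem conformalProfile_pos (hr : 0 < r) : 0 < conformalProfile α r := by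
  unfold conformalProfile
  positivity

theorem hasDerivAt_rpow_radial (s : ℝ) (hr : 0 < r) :
    HasDerivAt (fun t : ℝ => t ^ s) (s * r ^ s / r) r := by
  refine (Real.hasDerivAt_rpow_const (p := s) (Or.inl hr.ne')).congr_deriv ?_
  rw [Real.rpow_sub_one hr.ne']
  ring

/-- With `t = α log r` one has `σ = -α tanh t`, which solves this Riccati equation. Derivatives of
all the radial data are therefore polynomial in `σ`, up to powers of `r` and the profile itself. -/
theorem hasDerivAt_scaledCos (hr : 0 < r) :
    HasDerivAt (scaledCos α) (-(α ^ 2 - scaledCos α r ^ 2) / r) r := by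
  have h := hasDerivAt_rpow_radial (2 * α) hr
  have hpos : 0 < 1 + r ^ (2 * α) := by positivity
  refine (((h.const_sub 1).const_mul α).div (h.const_add 1) hpos.ne').congr_deriv ?_
  unfold scaledCos
  field_simp
  ring

theorem hasDerivAt_conformalProfile (hr : 0 < r) :
    HasDerivAt (conformalProfile α) (conformalProfile α r * (2 - 2 * scaledCos α r) / r) r := by
  have h := hasDerivAt_rpow_radial (2 * α) hr
  have hpos : 0 < 1 + r ^ (2 * α) := by positivity
  refine (((hasDerivAt_rpow_radial (2 * (1 - α)) hr).mul ((h.const_add 1).pow 2)).div_const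
    4).congr_deriv ?_
  unfold scaledCos conformalProfile
  field_simp
  simp
  ring

/-- With `t = α log r`, the factors are `r² cosh² t` and `α² / cosh² t`. -/
theorem conformalProfile_mul_sq_sub (hr : 0 < r) :
    conformalProfile α r * (α ^ 2 - scaledCos α r ^ 2) = α ^ 2 * r ^ 2 := by
  have hpos : 0 < 1 + r ^ (2 * α) := by positivity
  have h : r ^ (2 * (1 - α)) * r ^ (2 * α) = r ^ 2 := by
    rw [← Real.rpow_add hr, ← Real.rpow_natCast]
    congr 1
    push_cast
    ring
  unfold scaledCos conformalProfile
  rw [← h]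
  field_simp
  ring

/-- Logarithmic derivative of the Riemannian volume density of the cometric `c δ`, `c` the conformal
profile. -/
theorem hasDerivAt_volProfile (d : ℕ) (hr : 0 < r) :
    HasDerivAt (fun t => (√(conformalProfile α t ^ d))⁻¹)
      ((√(conformalProfile α r ^ d))⁻¹ * (-d * (1 - scaledCos α r)) / r) r := by
  have hc := conformalProfile_pos (α := α) hr
  have h1 : 0 < conformalProfile α r ^ d := by positivity
  have h2 : 0 < √(conformalProfile α r ^ d) := by positivity
  refine ((((hasDerivAt_conformalProfile hr).pow d).sqrt h1.ne').inv h2.ne').congr_deriv ?_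
  simp only [Pi.pow_apply]
  rw [Real.sq_sqrt h1.le]
  -- The derivative of a `d`-th power carries the truncated exponent `d - 1`, so `d = 0` is treated
  -- apart.
  rcases d with _ | d
  · simp
  · simp only [Nat.add_sub_cancel]
    field_simp
    ring

/-- The radial profile of the density of `μ`. -/
noncomputable def densityProfile (α n κ r : ℝ) : ℝ :=
  (2 : ℝ) ^ n * r ^ κ / (1 + r ^ (2 * α)) ^ n

theorem densityProfile_pos (n κ : ℝ) (hr : 0 < r) : 0 < densityProfile α n κ r := by
  unfold densityProfile
  positivity

theorem hasDerivAt_densityProfile (n κ : ℝ) (hr : 0 < r) :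
    HasDerivAt (densityProfile α n κ)
      (densityProfile α n κ r * (κ - n * (α - scaledCos α r)) / r) r := by
  have h := hasDerivAt_rpow_radial (2 * α) hr
  have hpos : 0 < 1 + r ^ (2 * α) := by positivity
  have h1 : 0 < (1 + r ^ (2 * α)) ^ n := by positivity
  refine (((hasDerivAt_rpow_radial κ hr).const_mul ((2 : ℝ) ^ n)).div ((h.const_add 1).rpow_const
    (p := n) (Or.inl hpos.ne')) h1.ne').congr_deriv ?_
  rw [Real.rpow_sub_one hpos.ne']
  unfold scaledCos densityProfile
  field_simp
  ring

/-- Derivative of the radial profile of the weight `W`. -/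
theorem hasDerivAt_weightProfile (d : ℕ) (n : ℝ) (hr : 0 < r) :
    HasDerivAt (fun t => -Real.log (densityProfile α n (α * n - d) t /
      (√(conformalProfile α t ^ d))⁻¹)) (-(n - d) * scaledCos α r / r) r := by
  have hc := conformalProfile_pos (α := α) hr
  have h0 := densityProfile_pos (α := α) n (α * n - d) hr
  have h1 : 0 < (√(conformalProfile α r ^ d))⁻¹ := by positivity
  refine ((((hasDerivAt_densityProfile n (α * n - d) hr).div (hasDerivAt_volProfile d hr)
    h1.ne').log (div_pos h0 h1).ne').neg).congr_deriv ?_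
  simp only [Pi.div_apply]
  generalize (√(conformalProfile α r ^ d))⁻¹ = v at h1
  field_simp
  ring

/-! ### The spherical CKN space as a radial conformal structure -/

open WeightedManifold

theorem generator_sphericalSpace {d : ℕ} {a b : ℝ}
    (hκ : -b * pCrit d a b = alpha d a b * intrinsicDim d a b - d)
    {f : EuclideanSpace ℝ (Fin d) → ℝ} (hf : ContDiffOn ℝ ∞ f {0}ᶜ)
    {x : EuclideanSpace ℝ (Fin d)} (hx : x ≠ 0) :
    (sphericalSpace d a b).generator f x = conformalProfile (alpha d a b) ‖x‖ *
      (flatLaplacian f x + ((2 - d) + (intrinsicDim d a b - 2) * scaledCos (alpha d a b) ‖x‖)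
        / ‖x‖ ^ 2 * eulerField f x) := by
  set α := alpha d a b
  set n := intrinsicDim d a b
  have hr : 0 < ‖x‖ := norm_pos_iff.mpr hx
  have hU : IsOpen ({0}ᶜ : Set (EuclideanSpace ℝ (Fin d))) := isOpen_compl_singleton
  have dp : ∀ i, DifferentiableAt ℝ (partialDeriv i f) x :=
    fun i => differentiableAt_of_contDiffOn hU (contDiffOn_partialDeriv hU hf i) hx
  have hcm : ∀ y, (sphericalSpace d a b).cometric y =
      conformalProfile α ‖y‖ • (1 : Matrix (Fin d) (Fin d) ℝ) := fun y => rfl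
  have hvol : (sphericalSpace d a b).volDensity
      = fun y => (√(conformalProfile α ‖y‖ ^ d))⁻¹ := by
    funext y
    simp [volDensity, hcm]
  have hW : (sphericalSpace d a b).weight = fun y =>
      -Real.log (densityProfile α n (α * n - d) ‖y‖ / (√(conformalProfile α ‖y‖ ^ d))⁻¹) := by
    funext y
    rw [weight, hvol, ← hκ]
    rfl
  have gv : HasRadialGradient (fun y : EuclideanSpace ℝ (Fin d) => (√(conformalProfile α ‖y‖ ^ d))⁻¹)
      (fun y => (√(conformalProfile α ‖y‖ ^ d))⁻¹ * (-d * (1 - scaledCos α ‖y‖)) / ‖y‖ ^ 2) :=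
    hasRadialGradient_of_hasDerivAt
      (G := fun t => (√(conformalProfile α t ^ d))⁻¹ * (-d * (1 - scaledCos α t)) / t ^ 2) fun t ht => by
      refine (hasDerivAt_volProfile (α := α) d ht).congr_deriv ?_
      field_simp
  have gc : HasRadialGradient (fun y : EuclideanSpace ℝ (Fin d) => conformalProfile α ‖y‖)
      (fun y => conformalProfile α ‖y‖ * (2 - 2 * scaledCos α ‖y‖) / ‖y‖ ^ 2) :=
    hasRadialGradient_of_hasDerivAt
      (G := fun t => conformalProfile α t * (2 - 2 * scaledCos α t) / t ^ 2) fun t ht => by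
      refine (hasDerivAt_conformalProfile (α := α) ht).congr_deriv ?_
      field_simp
  have gW : HasRadialGradient (sphericalSpace d a b).weight
      (fun y => -(n - d) * scaledCos α ‖y‖ / ‖y‖ ^ 2) := by
    rw [hW]
    exact hasRadialGradient_of_hasDerivAt
      (F := fun t => -Real.log (densityProfile α n (α * n - d) t / (√(conformalProfile α t ^ d))⁻¹))
      (G := fun t => -(n - d) * scaledCos α t / t ^ 2) fun t ht => by
      refine (hasDerivAt_weightProfile (α := α) d n ht).congr_deriv ?_
      field_simp
  have hv : 0 < (√(conformalProfile α ‖x‖ ^ d))⁻¹ := by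
    have := conformalProfile_pos (α := α) hr
    positivity
  have hsum : ∀ y i, ∑ j, (sphericalSpace d a b).cometric y i j * partialDeriv j f y
      = conformalProfile α ‖y‖ * partialDeriv i f y := by
    intro y i
    simp [hcm, Matrix.one_apply]
  unfold generator laplaceBeltrami carreDuChamp
  simp only [mul_assoc, hsum, hvol]
  have hW2 : ∑ i, ∑ j, (sphericalSpace d a b).cometric x i j *
        (partialDeriv i (sphericalSpace d a b).weight x * partialDeriv j f x)
      = ∑ i, conformalProfile α ‖x‖ * (-(n - d) * scaledCos α ‖x‖ / ‖x‖ ^ 2)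
          * (x i * partialDeriv i f x) := by
    refine Finset.sum_congr rfl fun i _ => ?_
    rw [gW.partialDeriv hx]
    simp [hcm, Matrix.one_apply]
    ring
  rw [hW2, Finset.mul_sum, ← Finset.sum_sub_distrib]
  unfold flatLaplacian eulerField
  rw [Finset.mul_sum, ← Finset.sum_add_distrib, Finset.mul_sum]
  refine Finset.sum_congr rfl fun i _ => ?_
  rw [partialDeriv_mul (gv.differentiableAt hx) ((gc.differentiableAt hx).fun_mul (dp i)),
    partialDeriv_mul (gc.differentiableAt hx) (dp i), gv.partialDeriv hx, gc.partialDeriv hx]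
  -- Only the logarithmic derivative of the volume density matters: its value cancels. The drift is
  -- `(2 - d)(1 - σ)` from the conformal change plus `(n - d) σ` from the weight.
  generalize (√(conformalProfile α ‖x‖ ^ d))⁻¹ = v at hv
  field_simp
  ring

theorem isRadialConformal_sphericalSpace {d : ℕ} {a b : ℝ}
    (hκ : -b * pCrit d a b = alpha d a b * intrinsicDim d a b - d) :
    (sphericalSpace d a b).IsRadialConformal
      (fun x => conformalProfile (alpha d a b) ‖x‖)
      (fun x => conformalProfile (alpha d a b) ‖x‖ * (2 - 2 * scaledCos (alpha d a b) ‖x‖)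
        / ‖x‖ ^ 2)
      (fun x => conformalProfile (alpha d a b) ‖x‖ * ((2 - 2 * scaledCos (alpha d a b) ‖x‖) ^ 2
        + 2 * (alpha d a b ^ 2 - scaledCos (alpha d a b) ‖x‖ ^ 2)
        - 2 * (2 - 2 * scaledCos (alpha d a b) ‖x‖)) / ‖x‖ ^ 4)
      (fun x => ((2 - d) + (intrinsicDim d a b - 2) * scaledCos (alpha d a b) ‖x‖) / ‖x‖ ^ 2)
      (fun x => (-(intrinsicDim d a b - 2) * (alpha d a b ^ 2 - scaledCos (alpha d a b) ‖x‖ ^ 2)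
        - 2 * ((2 - d) + (intrinsicDim d a b - 2) * scaledCos (alpha d a b) ‖x‖)) / ‖x‖ ^ 4) := by
  set α := alpha d a b
  set n := intrinsicDim d a b
  have hsq : ∀ t : ℝ, HasDerivAt (fun t : ℝ => t ^ 2) (2 * t) t := fun t => by
    simpa using hasDerivAt_pow 2 t
  refine ⟨?_, ?_, ?_, ?_, ?_, fun f hf x hx => generator_sphericalSpace hκ hf hx⟩
  · intro x hx
    have hx : x ≠ 0 := hx
    have h1 : ∀ s : ℝ, ContDiffAt ℝ ∞ (fun y : EuclideanSpace ℝ (Fin d) => ‖y‖ ^ s) x := fun s =>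
      (contDiffAt_norm ℝ hx).rpow_const_of_ne (norm_ne_zero_iff.mpr hx)
    exact (((h1 _).mul ((contDiffAt_const.add (h1 _)).pow 2)).div_const 4).contDiffWithinAt
  · exact hasRadialGradient_of_hasDerivAt
      (G := fun t => conformalProfile α t * (2 - 2 * scaledCos α t) / t ^ 2) fun t ht => by
      refine (hasDerivAt_conformalProfile (α := α) ht).congr_deriv ?_
      field_simp
  · exact hasRadialGradient_of_hasDerivAt
      (F := fun t => conformalProfile α t * (2 - 2 * scaledCos α t) / t ^ 2)
      (G := fun t => conformalProfile α t * ((2 - 2 * scaledCos α t) ^ 2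
        + 2 * (α ^ 2 - scaledCos α t ^ 2) - 2 * (2 - 2 * scaledCos α t)) / t ^ 4) fun t ht => by
      refine (((hasDerivAt_conformalProfile (α := α) ht).mul (((hasDerivAt_scaledCos (α := α)
        ht).const_mul 2).const_sub 2)).div (hsq t) (by positivity)).congr_deriv ?_
      simp only [Pi.mul_apply]
      field_simp
  · exact hasRadialGradient_of_hasDerivAt
      (F := fun t => ((2 - d) + (n - 2) * scaledCos α t) / t ^ 2)
      (G := fun t => (-(n - 2) * (α ^ 2 - scaledCos α t ^ 2)
        - 2 * ((2 - d) + (n - 2) * scaledCos α t)) / t ^ 4) fun t ht => by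
      refine ((((hasDerivAt_scaledCos (α := α) ht).const_mul (n - 2)).const_add (2 - (d : ℝ))).div
        (hsq t) (by positivity)).congr_deriv ?_
      field_simp
  · intro f h x
    have hcm : (sphericalSpace d a b).cometric x =
      conformalProfile α ‖x‖ • (1 : Matrix (Fin d) (Fin d) ℝ) := rfl
    simp [carreDuChamp, hcm, Matrix.one_apply, Finset.mul_sum, mul_assoc]

/-! ### Trace inequality for the conformal Hessian -/

/-- `|H|² ≥ (tr H)² / d` for the conformally changed Hessian
`H = A + μ (x ⊗ p + p ⊗ x) - μ (x·p) 1`, expanded. -/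
theorem conformalHessian_trace_sq_le {d : ℕ} (A : Fin d → Fin d → ℝ) (hA : ∀ i j, A i j = A j i)
    (x p : Fin d → ℝ) (μ : ℝ) :
    ((∑ i, A i i) + (2 - d) * μ * ∑ i, x i * p i) ^ 2 ≤
      d * ((∑ i, ∑ j, A i j ^ 2) + 4 * μ * (∑ i, ∑ j, x i * (A i j * p j))
        - 2 * μ * (∑ i, x i * p i) * (∑ i, A i i)
        + 2 * μ ^ 2 * (∑ i, x i ^ 2) * (∑ i, p i ^ 2)
        + (d - 2) * μ ^ 2 * (∑ i, x i * p i) ^ 2) := by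
  set P := ∑ i, x i * p i with hP
  let H : Fin d → Fin d → ℝ := fun i j =>
    A i j + μ * (x i * p j + p i * x j) - if i = j then μ * P else 0
  have h1 : (∑ i, H i i) ^ 2 ≤ d * ∑ i, H i i ^ 2 := by
    simpa using sq_sum_le_card_mul_sum_sq (s := Finset.univ) (f := fun i => H i i)
  have h2 : ∑ i, H i i ^ 2 ≤ ∑ i, ∑ j, H i j ^ 2 := Finset.sum_le_sum fun i _ =>
    Finset.single_le_sum (f := fun j => H i j ^ 2) (fun j _ => sq_nonneg _) (Finset.mem_univ i)
  have h3 : ∑ i, H i i = (∑ i, A i i) + (2 - d) * μ * P := by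
    simp only [H, Finset.sum_sub_distrib, Finset.sum_add_distrib, ← Finset.mul_sum, if_true,
      Finset.sum_const, Finset.card_univ, Fintype.card_fin, nsmul_eq_mul, mul_comm (p _) (x _), ← hP]
    ring
  have h4 : ∑ i, ∑ j, H i j ^ 2 = (∑ i, ∑ j, A i j ^ 2) + 4 * μ * (∑ i, ∑ j, x i * (A i j * p j))
        - 2 * μ * P * (∑ i, A i i) + 2 * μ ^ 2 * (∑ i, x i ^ 2) * (∑ i, p i ^ 2)
        + (d - 2) * μ ^ 2 * P ^ 2 := by
    -- The last summand is the diagonal correction `(X - μP)² - X²` with `X = A i i + 2μ x i p i`.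
    -- Writing `A j i` in one cross term makes it the transpose of the other.
    have e1 : ∀ i j, H i j ^ 2 = A i j ^ 2 + 2 * μ * (x i * (A i j * p j))
        + 2 * μ * (x j * (A j i * p i)) + μ ^ 2 * (x i ^ 2 * p j ^ 2) + μ ^ 2 * (p i ^ 2 * x j ^ 2)
        + 2 * μ ^ 2 * ((x i * p i) * (x j * p j))
        + if i = j then μ ^ 2 * P ^ 2 - 2 * μ * P * A i i - 4 * μ ^ 2 * P * (x i * p i)
          else 0 := by
      intro i j
      simp only [H]
      split_ifs with h
      · subst h
        ring
      · rw [hA j i]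
        ring
    have e2 : ∑ i, ∑ j, x j * (A j i * p i) = ∑ i, ∑ j, x i * (A i j * p j) := Finset.sum_comm
    simp only [e1, Finset.sum_add_distrib, ← Finset.mul_sum, ← Finset.sum_mul, e2, ← hP,
      Finset.sum_ite_eq, Finset.mem_univ, if_true, Finset.sum_sub_distrib, Finset.sum_const,
      Finset.card_univ, Fintype.card_fin, nsmul_eq_mul]
    ring
  rw [h3] at h1
  rw [← h4]
  exact h1.trans (mul_le_mul_of_nonneg_left h2 (Nat.cast_nonneg d))

end CKN

/-! ### Deficit identity, sufficiency and necessity -/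

namespace CKN

open WeightedManifold

/-- The Bakry-Émery deficit of the spherical CKN space, as a sum of a trace-free Hessian part, a
square, and the tangential part of the gradient with coefficient `𝔅`. -/
theorem gammaTwo_sphericalSpace_sub {d : ℕ} (hd : 0 < d) {a b : ℝ}
    (hκ : -b * pCrit d a b = alpha d a b * intrinsicDim d a b - d)
    (hn : intrinsicDim d a b ≠ 0)
    {f : EuclideanSpace ℝ (Fin d) → ℝ} (hf : ContDiffOn ℝ ∞ f {0}ᶜ)
    {x : EuclideanSpace ℝ (Fin d)} (hx : x ≠ 0) {c σ n μ P Δ N : ℝ}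
    (hc : c = conformalProfile (alpha d a b) ‖x‖) (hσ : σ = scaledCos (alpha d a b) ‖x‖)
    (hn' : n = intrinsicDim d a b) (hμ : μ = (1 - σ) / ‖x‖ ^ 2)
    (hP : P = ∑ i, x i * partialDeriv i f x) (hΔ : Δ = ∑ i, partialDeriv i (partialDeriv i f) x)
    (hN : N = ∑ i, partialDeriv i f x ^ 2) :
    (sphericalSpace d a b).gammaTwo f x
      - (alpha d a b ^ 2 * (n - 1) * (sphericalSpace d a b).carreDuChamp f f x
        + 1 / n * (sphericalSpace d a b).generator f x ^ 2)
      = c ^ 2 * ((∑ i, ∑ j, partialDeriv i (partialDeriv j f) x ^ 2)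
          + 4 * μ * (∑ i, ∑ j, x i * (partialDeriv i (partialDeriv j f) x * partialDeriv j f x))
          - 2 * μ * P * Δ + 2 * μ ^ 2 * ‖x‖ ^ 2 * N + (d - 2) * μ ^ 2 * P ^ 2
          - (Δ + (2 - d) * μ * P) ^ 2 / d
          + (n - d) / (d * n) * (Δ + (2 - d) * μ * P - d * σ * P / ‖x‖ ^ 2) ^ 2)
        + c ^ 2 / ‖x‖ ^ 4 * bDGZ d a b * (‖x‖ ^ 2 * N - P ^ 2) := by
  have hr : 0 < ‖x‖ := norm_pos_iff.mpr hx
  have hM := isRadialConformal_sphericalSpace hκ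
  have hcσ := conformalProfile_mul_sq_sub (α := alpha d a b) hr
  have hgen := hM.generator_eq f hf x hx
  have hcarre := hM.carreDuChamp_eq f f x
  have hgam := hM.gammaTwo_eq hf hx
  have hN2 : ∑ i, partialDeriv i f x * partialDeriv i f x = N := by
    rw [hN]
    exact Finset.sum_congr rfl fun i _ => (sq _).symm
  have hE : eulerField f x = P := hP.symm
  have hL : flatLaplacian f x = Δ := hΔ.symm
  rw [hN2] at hcarre
  rw [hE, hL] at hgen hgam
  rw [← hN] at hgam
  rw [hgen, hgam, hcarre, bDGZ]
  simp only [← hc, ← hσ, ← hn'] at hcσ ⊢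
  rw [← hn'] at hn
  -- The relation `c (α² - σ²) = α² r²` brings `ρ Γ(f)` to the order `c²` of the other terms. After
  -- this the claim is a rational identity with `α` and `σ` independent.
  have hρ : alpha d a b ^ 2 * (n - 1) * (c * N)
      = (n - 1) * N * c ^ 2 * (alpha d a b ^ 2 - σ ^ 2) / ‖x‖ ^ 2 := by
    rw [eq_div_iff (by positivity)]
    linear_combination -(n - 1) * N * c * hcσ
  have hd' : (d : ℝ) ≠ 0 := by positivity
  rw [hρ, hμ]
  field_simp
  ring

theorem curvatureDimension_sphericalSpace {d : ℕ} (hd : 0 < d) {a b : ℝ}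
    (hκ : -b * pCrit d a b = alpha d a b * intrinsicDim d a b - d)
    (hn : (d : ℝ) ≤ intrinsicDim d a b) (hB : 0 ≤ bDGZ d a b) :
    (sphericalSpace d a b).CurvatureDimension
      (alpha d a b ^ 2 * (intrinsicDim d a b - 1)) (intrinsicDim d a b) := by
  intro f hf x hx
  have hd' : (0 : ℝ) < d := by exact_mod_cast hd
  have hn0 : 0 < intrinsicDim d a b := hd'.trans_le hn
  have hx : x ≠ 0 := hx
  have hr : 0 < ‖x‖ := norm_pos_iff.mpr hx
  have hid := gammaTwo_sphericalSpace_sub hd hκ hn0.ne' hf hx rfl rfl rfl rfl rfl rfl rfl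
  have hH := conformalHessian_trace_sq_le (fun i j => partialDeriv i (partialDeriv j f) x)
    (fun i j => partialDeriv_comm isOpen_compl_singleton hf hx i j) x
    (fun i => partialDeriv i f x) ((1 - scaledCos (alpha d a b) ‖x‖) / ‖x‖ ^ 2)
  have hCS : (∑ i, x i * partialDeriv i f x) ^ 2 ≤ ‖x‖ ^ 2 * ∑ i, partialDeriv i f x ^ 2 := by
    rw [EuclideanSpace.real_norm_sq_eq]
    exact Finset.sum_mul_sq_le_sq_mul_sq _ _ _
  rw [← EuclideanSpace.real_norm_sq_eq, ← div_le_iff₀' hd'] at hH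
  rw [← sub_nonneg, hid]
  have h1 : 0 ≤ (intrinsicDim d a b - d) / (d * intrinsicDim d a b) :=
    div_nonneg (sub_nonneg.2 hn) (by positivity)
  refine add_nonneg (mul_nonneg (sq_nonneg _) (add_nonneg (sub_nonneg.2 hH)
    (mul_nonneg h1 (sq_nonneg _)))) (mul_nonneg (mul_nonneg (by positivity) hB)
      (sub_nonneg.2 hCS))

/-- Test the condition at a unit vector with a function whose Riemannian Hessian vanishes there and
whose gradient is tangential and of unit length: the deficit is then exactly `𝔅`. -/
theorem bDGZ_nonneg_of_curvatureDimension {d : ℕ} (hd : 2 ≤ d) {a b : ℝ}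
    (hκ : -b * pCrit d a b = alpha d a b * intrinsicDim d a b - d)
    (hn : intrinsicDim d a b ≠ 0)
    (hCD : (sphericalSpace d a b).CurvatureDimension
      (alpha d a b ^ 2 * (intrinsicDim d a b - 1)) (intrinsicDim d a b)) :
    0 ≤ bDGZ d a b := by
  let i₀ : Fin d := ⟨0, by omega⟩
  let i₁ : Fin d := ⟨1, by omega⟩
  have h01 : i₀ ≠ i₁ := by simp [i₀, i₁]
  -- At `e = e₀` this has gradient `e₁` and flat Hessian `-(e₀ ⊗ e₁ + e₁ ⊗ e₀)`, which cancels `μ (x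
  -- ⊗ p + p ⊗ x)` for `μ = 1`. The constant `2` normalizes the gradient.
  let f : EuclideanSpace ℝ (Fin d) → ℝ := fun y => y i₁ * (2 - y i₀)
  have hf : ContDiff ℝ ∞ f := by fun_prop
  have hp : ∀ i, partialDeriv i f = fun y =>
      (if i = i₁ then 1 else 0) * (2 - y i₀) + y i₁ * (if i = i₀ then -1 else 0) := by
    intro i
    funext y
    have h2 : partialDeriv i (fun y : EuclideanSpace ℝ (Fin d) => 2 - y i₀) y
        = if i = i₀ then -1 else 0 := by
      have h3 := partialDeriv_coord (x := y) (i := i) i₀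
      unfold partialDeriv at h3 ⊢
      rw [fderiv_const_sub, neg_apply, h3]
      split_ifs <;> simp
    rw [partialDeriv_mul (differentiableAt_coord _) (by fun_prop), partialDeriv_coord, h2]
  have hA : ∀ i j y, partialDeriv i (partialDeriv j f) y
      = (if j = i₁ then 1 else 0) * (if i = i₀ then -1 else 0)
        + (if i = i₁ then 1 else 0) * (if j = i₀ then -1 else 0) := by
    intro i j y
    have h3 := partialDeriv_coord (x := y) (i := i) i₀
    have h4 := partialDeriv_coord (x := y) (i := i) i₁
    rw [hp]
    unfold partialDeriv at h3 h4 ⊢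
    rw [fderiv_fun_add (by fun_prop) (by fun_prop), fderiv_const_mul (by fun_prop),
      fderiv_mul_const (by fun_prop), fderiv_const_sub]
    simp only [add_apply, smul_apply, neg_apply, h3, h4, smul_eq_mul]
    split_ifs <;> simp
  let e : EuclideanSpace ℝ (Fin d) := EuclideanSpace.single i₀ 1
  have he : ‖e‖ = 1 := by simp [e]
  have he0 : e ≠ 0 := by
    rw [← norm_ne_zero_iff, he]
    exact one_ne_zero
  have hei : ∀ i, e i = if i = i₀ then 1 else 0 := fun i => by simp [e]
  have hpe : ∀ i, partialDeriv i f e = if i = i₁ then 1 else 0 := by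
    intro i
    rw [hp]
    simp only [hei, if_neg h01.symm, if_true]
    norm_num
  -- The unit sphere is the equator: `σ = 0` and `c = 1`, hence `μ = 1`.
  have hσ : scaledCos (alpha d a b) ‖e‖ = 0 := by simp [scaledCos, he]
  have hc : conformalProfile (alpha d a b) ‖e‖ = 1 := by
    simp [conformalProfile, he]
    norm_num
  have hid := gammaTwo_sphericalSpace_sub (by omega) hκ hn hf.contDiffOn he0
    hc.symm hσ.symm rfl rfl rfl rfl rfl
  have hle := sub_nonneg.2 (hCD f hf.contDiffOn e he0)
  have hP : ∑ i, e i * partialDeriv i f e = 0 := by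
    simp [hei, hpe, h01.symm]
  have hΔ : ∑ i, partialDeriv i (partialDeriv i f) e = 0 := by
    refine Finset.sum_eq_zero fun i _ => ?_
    rw [hA]
    by_cases h : i = i₀
    · simp [h, h01]
    · simp [h]
  have hN : ∑ i, partialDeriv i f e ^ 2 = 1 := by
    simp [hpe]
  have hS : ∑ i, ∑ j, partialDeriv i (partialDeriv j f) e ^ 2 = 2 := by
    have h : ∀ i j, partialDeriv i (partialDeriv j f) e ^ 2
        = (if j = i₁ then (if i = i₀ then 1 else 0) else 0)
          + (if j = i₀ then (if i = i₁ then 1 else 0) else 0) := by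
      intro i j
      rw [hA]
      by_cases h1 : j = i₁
      · subst h1
        simp [h01.symm]
      · simp [h1]
    simp only [h, Finset.sum_add_distrib, Finset.sum_ite_eq', Finset.mem_univ, if_true]
    norm_num
  have hQ : ∑ i, ∑ j, e i * (partialDeriv i (partialDeriv j f) e * partialDeriv j f e) = -1 := by
    simp [hA, hei, hpe, h01]
  rw [hid, hP, hΔ, hN, hS, hQ, he] at hle
  -- The Hessian part is `2 + 4·(-1) + 2 = 0`.
  norm_num at hle
  exact hle

theorem alpha_eq {d : ℕ} (a b : ℝ) (h : (d : ℝ) - 2 + 2 * (b - a) ≠ 0) :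
    alpha d a b = (1 + a - b) * (d - 2 - 2 * a) / (d - 2 + 2 * (b - a)) := by
  rw [alpha, pCrit]
  field_simp
  ring

/-- With this exponent the density has logarithmic slope `nσ - d` in `log r`. The constant `-d` is
absorbed by the Riemannian volume, so the slope of `W` is proportional to `σ`. -/
theorem neg_mul_pCrit {d : ℕ} (a b : ℝ) (h : (d : ℝ) - 2 + 2 * (b - a) ≠ 0)
    (hs : 1 + a - b ≠ 0) :
    -b * pCrit d a b = alpha d a b * intrinsicDim d a b - d := by
  rw [alpha_eq a b h, pCrit, intrinsicDim]
  field_simp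
  ring

end CKN

theorem proposition1 (d : ℕ) (hd : 3 ≤ d) (a b : ℝ) (hab : (a, b) ∈ CKN.Theta d)
    (hα : 0 < CKN.alpha d a b) (ρ : ℝ)
    (hρ : ρ = CKN.alpha d a b ^ 2 * (CKN.intrinsicDim d a b - 1)) :
    ((CKN.sphericalSpace d a b).CurvatureDimension ρ (CKN.intrinsicDim d a b) ↔
      CKN.alpha d a b ^ 2 ≤ ((d : ℝ) - 2) / (CKN.intrinsicDim d a b - 2)) ∧
    (CKN.alpha d a b ^ 2 ≤ ((d : ℝ) - 2) / (CKN.intrinsicDim d a b - 2) ↔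
      0 ≤ CKN.bDGZ d a b) := by
  obtain ⟨h1, h2, -⟩ := hab
  simp only at h1 h2
  have hd3 : (3 : ℝ) ≤ d := by exact_mod_cast hd
  have hp : 0 < (d : ℝ) - 2 + 2 * (b - a) := by linarith
  -- At `b = a + 1` the formula for `α` gives `0`, against `α > 0`.
  have hs : 0 < 1 + a - b := by
    refine lt_of_le_of_ne (by linarith) fun h => ?_
    rw [CKN.alpha_eq a b hp.ne', ← h] at hα
    simp at hα
  -- Here `a ≤ b` enters: `1 + a - b ≤ 1`. Together with `d ≥ 3` this also gives `n - 2 > 0`, needed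
  -- to clear the denominator.
  have hn : (d : ℝ) ≤ CKN.intrinsicDim d a b := by
    rw [CKN.intrinsicDim, le_div_iff₀ hs]
    nlinarith
  have hκ := CKN.neg_mul_pCrit a b hp.ne' hs.ne'
  have hiff : CKN.alpha d a b ^ 2 ≤ ((d : ℝ) - 2) / (CKN.intrinsicDim d a b - 2) ↔
      0 ≤ CKN.bDGZ d a b := by
    rw [le_div_iff₀ (by linarith), CKN.bDGZ, sub_nonneg, mul_comm]
  refine ⟨?_, hiff⟩
  rw [hiff, hρ]
  exact ⟨CKN.bDGZ_nonneg_of_curvatureDimension (by omega) hκ (by linarith),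
    CKN.curvatureDimension_sphericalSpace (by omega) hκ hn⟩
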